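/- Let $K\ge 0$, let $M_j,N_j,d_j$ ($1\le j\le K$) be natural numbers, let $\Phi\subseteq\{1,\dots,K\}^2$, and let $\Phi_R,\Phi_T\subseteq\{1,\dots,K\}$ be the first and second projections of $\Phi$. Put $$\mathcal H=\prod_{(k,l)\in\Phi}\mathbb P\big(\mathcal M_{N_k\times M_l}(\mathbb C)\big),\qquad \mathcal S=\Big(\prod_{k\in\Phi_R}\mathbb G(d_k,N_k)\Big)\times\Big(\prod_{l\in\Phi_T}\mathbb G(d_l,M_l)\Big),$$ where $\mathbb G(a,b)$ is the Grassmannian of $a$-dimensional linear subspaces of $\mathbb C^b$, with their usual complex manifold structures. An affine representative of $(H,U,V)\in\mathcal H\times\mathcal S$ is a family $(\tilde H,\tilde U,\tilde V)$ of complex matrices such that $\tilde H_{kl}\in\mathcal M_{N_k\times M_l}(\mathbb C)$ is nonzero and spans the line $H_{kl}$ for $(k,l)\in\Phi$, and the columns of $\tilde U_k\in\mathcal M_{N_k\times d_k}(\mathbb C)$ (resp. $\tilde V_l\in\mathcal M_{M_l\times d_l}(\mathbb C)$) span $U_k$ for $k\in\Phi_R$ (resp. $V_l$ for $l\in\Phi_T$).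 Let $$\mathcal V=\{(H,U,V)\in\mathcal H\times\mathcal S:\ \tilde U_k^T\tilde H_{kl}\tilde V_l=0\ \text{ for all }(k,l)\in\Phi\}$$ be the solution variety (the condition does not depend on the representative; $\mathcal V$ is a complex submanifold of $\mathcal H\times\mathcal S$), and let $\pi_1:\mathcal V\to\mathcal H$ be the projection $(H,U,V)\mapsto H$. The tangent space $T_x\mathcal V\subseteq T_x(\mathcal H\times\mathcal S)$ consists of the velocities at $0$ of holomorphic curves in $\mathcal V$ through $x$. A point $x\in\mathcal V$ is a regular point of $\pi_1$ if $D\pi_1(x):T_x\mathcal V\to T_{\pi_1(x)}\mathcal H$ is surjective. Let $(H,U,V)\in\mathcal V$ and let $(\tilde H,\tilde U,\tilde V)$ be any affine representative of it. Then $(H,U,V)$ is a regular point of $\pi_1$ if and only if the linear map $$\theta:\Big(\prod_{k\in\Phi_R}\mathcal M_{N_k\times d_k}(\mathbb C)\Big)\times\Big(\prod_{l\in\Phi_T}\mathcal M_{M_l\times d_l}(\mathbb C)\Big)\to\prod_{(k,l)\in\Phi}\mathcal M_{d_k\times d_l}(\mathbb C),$$ $$(\dot U,\dot V)\mapsto\big(\dot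 U_k^T\tilde H_{kl}\tilde V_l+\tilde U_k^T\tilde H_{kl}\dot V_l\big)_{(k,l)\in\Phi}$$ is surjective. -/

import Mathlib

open scoped Manifold ContDiff Topology LinearAlgebra.Projectivization

namespace InterferenceAlignment

noncomputable section

/-! Grassmannians as complex manifolds. -/

section Grassmannian

/-- The Grassmannian of `a`-dimensional linear subspaces of the complex vector space `W`. -/
def Gr (a : ℕ) (W : Type) [AddCommGroup W] [Module ℂ W] : Type :=
  {L : Submodule ℂ W // Module.finrank ℂ L = a}

/-- The model space of the charts of a Grassmannian: linear maps from `ℂ^a` to `ℂ^c`. -/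
abbrev GrModel (a c : ℕ) : Type := (Fin a → ℂ) →L[ℂ] (Fin c → ℂ)

variable {a c : ℕ} {W : Type} [AddCommGroup W] [Module ℂ W]

/-- The linear map `y ↦ g (y, A y)`. -/
def graphMap (g : ((Fin a → ℂ) × (Fin c → ℂ)) ≃ₗ[ℂ] W) (A : GrModel a c) :
    (Fin a → ℂ) →ₗ[ℂ] W :=
  g.toLinearMap ∘ₗ (LinearMap.id.prod A.toLinearMap)

lemma graphMap_apply (g : ((Fin a → ℂ) × (Fin c → ℂ)) ≃ₗ[ℂ] W) (A : GrModel a c)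
    (y : Fin a → ℂ) : graphMap g A y = g (y, A y) := rfl

lemma graphMap_injective (g : ((Fin a → ℂ) × (Fin c → ℂ)) ≃ₗ[ℂ] W) (A : GrModel a c) :
    Function.Injective (graphMap g A) := by
  intro y z h
  rw [graphMap_apply, graphMap_apply] at h
  exact congrArg Prod.fst (g.injective h)

/-- In the splitting `g` of `W` as `ℂ^a × ℂ^c`, the subspace which is the graph of `A`. -/
def grGraph (g : ((Fin a → ℂ) × (Fin c → ℂ)) ≃ₗ[ℂ] W) (A : GrModel a c) : Gr a W :=
  ⟨LinearMap.range (graphMap g A), by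
    rw [LinearMap.finrank_range_of_inj (graphMap_injective g A)]
    simp⟩

lemma grGraph_injective (g : ((Fin a → ℂ) × (Fin c → ℂ)) ≃ₗ[ℂ] W) :
    Function.Injective (grGraph g) := by
  intro A B h
  have h1 : LinearMap.range (graphMap g A) = LinearMap.range (graphMap g B) :=
    congrArg Subtype.val h
  ext1 y
  have h2 : graphMap g A y ∈ LinearMap.range (graphMap g B) := h1 ▸ ⟨y, rfl⟩
  obtain ⟨z, hz⟩ := h2
  rw [graphMap_apply, graphMap_apply] at hz
  have h3 := g.injective hz
  have h4 : z = y := congrArg Prod.fst h3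
  have h5 : B z = A y := congrArg Prod.snd h3
  rw [← h5, h4]

/-- The affine chart of the Grassmannian attached to a splitting `g` of `W` as `ℂ^a × ℂ^c`.
Its source consists of the graphs of linear maps `ℂ^a → ℂ^c`, that is, of the subspaces
complementary to `g (0 × ℂ^c)`, and it sends the graph of `A` to `A`. -/
def grChart (g : ((Fin a → ℂ) × (Fin c → ℂ)) ≃ₗ[ℂ] W) :
    PartialEquiv (Gr a W) (GrModel a c) :=
  ((grGraph_injective g).injOn.toPartialEquiv (grGraph g) Set.univ).symm

lemma grChart_source (g : ((Fin a → ℂ) × (Fin c → ℂ)) ≃ₗ[ℂ] W) :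
    (grChart g).source = Set.range (grGraph g) := Set.image_univ

lemma grChart_target (g : ((Fin a → ℂ) × (Fin c → ℂ)) ≃ₗ[ℂ] W) :
    (grChart g).target = Set.univ := rfl

lemma grChart_symm_apply (g : ((Fin a → ℂ) × (Fin c → ℂ)) ≃ₗ[ℂ] W) (A : GrModel a c) :
    (grChart g).symm A = grGraph g A := rfl

lemma grChart_grGraph (g : ((Fin a → ℂ) × (Fin c → ℂ)) ≃ₗ[ℂ] W) (A : GrModel a c) :
    grChart g (grGraph g A) = A :=
  (grChart g).right_inv (x := A) (Set.mem_univ A)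

/-- The change of splitting from `g` to `g'`. -/
def splitChange (g g' : ((Fin a → ℂ) × (Fin c → ℂ)) ≃ₗ[ℂ] W) :
    ((Fin a → ℂ) × (Fin c → ℂ)) →L[ℂ] ((Fin a → ℂ) × (Fin c → ℂ)) :=
  LinearMap.toContinuousLinearMap (g.trans g'.symm).toLinearMap

lemma splitChange_apply (g g' : ((Fin a → ℂ) × (Fin c → ℂ)) ≃ₗ[ℂ] W)
    (y : (Fin a → ℂ) × (Fin c → ℂ)) : g' (splitChange g g' y) = g y :=
  g'.apply_symm_apply (g y)

/-- First component, in the splitting `g'`, of the parametrized graph of `A` for `g`. -/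
def transFst (g g' : ((Fin a → ℂ) × (Fin c → ℂ)) ≃ₗ[ℂ] W) (A : GrModel a c) :
    (Fin a → ℂ) →L[ℂ] (Fin a → ℂ) :=
  (ContinuousLinearMap.fst ℂ _ _ ∘L splitChange g g' ∘L ContinuousLinearMap.inl ℂ _ _) +
    (ContinuousLinearMap.fst ℂ _ _ ∘L splitChange g g' ∘L ContinuousLinearMap.inr ℂ _ _) ∘L A

/-- Second component, in the splitting `g'`, of the parametrized graph of `A` for `g`. -/
def transSnd (g g' : ((Fin a → ℂ) × (Fin c → ℂ)) ≃ₗ[ℂ] W) (A : GrModel a c) :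
    (Fin a → ℂ) →L[ℂ] (Fin c → ℂ) :=
  (ContinuousLinearMap.snd ℂ _ _ ∘L splitChange g g' ∘L ContinuousLinearMap.inl ℂ _ _) +
    (ContinuousLinearMap.snd ℂ _ _ ∘L splitChange g g' ∘L ContinuousLinearMap.inr ℂ _ _) ∘L A

lemma splitChange_graph (g g' : ((Fin a → ℂ) × (Fin c → ℂ)) ≃ₗ[ℂ] W) (A : GrModel a c)
    (y : Fin a → ℂ) :
    splitChange g g' (y, A y) = (transFst g g' A y, transSnd g g' A y) := by
  have h : ((y, A y) : (Fin a → ℂ) × (Fin c → ℂ)) = (y, 0) + (0, A y) := by simp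
  rw [h, map_add]
  rfl

lemma graphMap_eq_trans (g g' : ((Fin a → ℂ) × (Fin c → ℂ)) ≃ₗ[ℂ] W) (A : GrModel a c)
    (y : Fin a → ℂ) : graphMap g A y = g' (transFst g g' A y, transSnd g g' A y) := by
  rw [← splitChange_graph, splitChange_apply, graphMap_apply]

lemma contDiff_transFst (g g' : ((Fin a → ℂ) × (Fin c → ℂ)) ≃ₗ[ℂ] W) :
    ContDiff ℂ ω (transFst g g') :=
  contDiff_const.add (contDiff_const.clm_comp contDiff_id)

lemma contDiff_transSnd (g g' : ((Fin a → ℂ) × (Fin c → ℂ)) ≃ₗ[ℂ] W) :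
    ContDiff ℂ ω (transSnd g g') :=
  contDiff_const.add (contDiff_const.clm_comp contDiff_id)

lemma grGraph_of_isUnit (g g' : ((Fin a → ℂ) × (Fin c → ℂ)) ≃ₗ[ℂ] W) (A : GrModel a c)
    (h : IsUnit (transFst g g' A)) :
    grGraph g A = grGraph g' (transSnd g g' A ∘L Ring.inverse (transFst g g' A)) := by
  have h1 : ∀ y, Ring.inverse (transFst g g' A) (transFst g g' A y) = y := fun y =>
    DFunLike.congr_fun (Ring.inverse_mul_cancel _ h) y
  have h2 : ∀ y, transFst g g' A (Ring.inverse (transFst g g' A) y) = y := fun y =>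
    DFunLike.congr_fun (Ring.mul_inverse_cancel _ h) y
  apply Subtype.ext
  apply le_antisymm
  · rintro _ ⟨y, rfl⟩
    refine ⟨transFst g g' A y, ?_⟩
    rw [graphMap_eq_trans g g', graphMap_apply, ContinuousLinearMap.comp_apply, h1]
  · rintro _ ⟨y, rfl⟩
    refine ⟨Ring.inverse (transFst g g' A) y, ?_⟩
    rw [graphMap_eq_trans g g', graphMap_apply, ContinuousLinearMap.comp_apply, h2]

lemma isUnit_of_grGraph_eq (g g' : ((Fin a → ℂ) × (Fin c → ℂ)) ≃ₗ[ℂ] W) (A B : GrModel a c)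
    (h : grGraph g A = grGraph g' B) : IsUnit (transFst g g' A) := by
  have hr : LinearMap.range (graphMap g A) = LinearMap.range (graphMap g' B) :=
    congrArg Subtype.val h
  have hinj : Function.Injective (transFst g g' A).toLinearMap := by
    rw [← LinearMap.ker_eq_bot, LinearMap.ker_eq_bot']
    intro y hy
    have hy' : transFst g g' A y = 0 := hy
    have hm : graphMap g A y ∈ LinearMap.range (graphMap g' B) := hr ▸ ⟨y, rfl⟩
    obtain ⟨z, hz⟩ := hm
    have hz2 := hz
    rw [graphMap_eq_trans g g', graphMap_apply, hy'] at hz2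
    have hz3 : z = 0 := congrArg Prod.fst (g'.injective hz2)
    rw [hz3, map_zero] at hz
    exact graphMap_injective g A (by rw [← hz, map_zero])
  have hu := (LinearMap.isUnit_iff_ker_eq_bot _).2 (LinearMap.ker_eq_bot.2 hinj)
  obtain ⟨e, he⟩ := hu
  have h1 : ∀ y, transFst g g' A ((e⁻¹).val y) = y := fun y => by
    have := DFunLike.congr_fun e.mul_inv y
    rw [he] at this
    exact this
  have h2 : ∀ y, (e⁻¹).val (transFst g g' A y) = y := fun y => by
    have := DFunLike.congr_fun e.inv_mul y
    rw [he] at this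
    exact this
  exact ⟨⟨transFst g g' A, LinearMap.toContinuousLinearMap (e⁻¹).val,
    ContinuousLinearMap.ext h1, ContinuousLinearMap.ext h2⟩, rfl⟩

lemma grChart_trans_source (g g' : ((Fin a → ℂ) × (Fin c → ℂ)) ≃ₗ[ℂ] W) :
    ((grChart g).symm.trans (grChart g')).source = {A | IsUnit (transFst g g' A)} := by
  ext A
  rw [PartialEquiv.trans_source, PartialEquiv.symm_source, grChart_target, grChart_source]
  simp only [Set.univ_inter, Set.mem_preimage, grChart_symm_apply, Set.mem_range,
    Set.mem_ofPred_eq]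
  constructor
  · rintro ⟨B, hB⟩
    exact isUnit_of_grGraph_eq g g' A B hB.symm
  · intro h
    exact ⟨_, (grGraph_of_isUnit g g' A h).symm⟩

lemma isOpen_grChart_trans_source (g g' : ((Fin a → ℂ) × (Fin c → ℂ)) ≃ₗ[ℂ] W) :
    IsOpen ((grChart g).symm.trans (grChart g')).source := by
  rw [grChart_trans_source]
  exact Units.isOpen.preimage (contDiff_transFst g g').continuous

lemma contDiffOn_grChart_trans (g g' : ((Fin a → ℂ) × (Fin c → ℂ)) ≃ₗ[ℂ] W) :
    ContDiffOn ℂ ω ((grChart g).symm.trans (grChart g'))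
      ((grChart g).symm.trans (grChart g')).source := by
  rw [grChart_trans_source]
  have h1 : ContDiffOn ℂ ω
      (fun A => transSnd g g' A ∘L Ring.inverse (transFst g g' A))
      {A | IsUnit (transFst g g' A)} := by
    intro A hA
    obtain ⟨u, hu⟩ := hA
    have h2 : ContDiffAt ℂ ω Ring.inverse (transFst g g' A) := by
      rw [← hu]
      exact contDiffAt_ringInverse ℂ u
    exact ((contDiff_transSnd g g').contDiffAt.clm_comp
      (h2.comp A (contDiff_transFst g g').contDiffAt)).contDiffWithinAt
  refine h1.congr ?_
  intro A hA
  change grChart g' (grGraph g A) = _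
  rw [grGraph_of_isUnit g g' A hA, grChart_grGraph]

lemma exists_splitting [FiniteDimensional ℂ W] (L : Gr a W) :
    ∃ g : ((Fin a → ℂ) × (Fin (Module.finrank ℂ W - a) → ℂ)) ≃ₗ[ℂ] W, grGraph g 0 = L := by
  obtain ⟨Q, hQ⟩ := Submodule.exists_isCompl L.1
  have hd := Submodule.finrank_add_eq_of_isCompl hQ
  rw [L.2] at hd
  have e1 : (Fin a → ℂ) ≃ₗ[ℂ] L.1 :=
    LinearEquiv.ofFinrankEq _ _ (by rw [L.2]; simp)
  have e2 : (Fin (Module.finrank ℂ W - a) → ℂ) ≃ₗ[ℂ] Q :=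
    LinearEquiv.ofFinrankEq _ _ (by simp; omega)
  refine ⟨(e1.prodCongr e2).trans (Submodule.prodEquivOfIsCompl L.1 Q hQ), ?_⟩
  apply Subtype.ext
  apply le_antisymm
  · rintro _ ⟨y, rfl⟩
    rw [graphMap_apply]
    simp
  · intro w hw
    refine ⟨e1.symm ⟨w, hw⟩, ?_⟩
    rw [graphMap_apply]
    simp

/-- The holomorphic atlas of the Grassmannian given by all splittings of `W`. -/
def grCore (a : ℕ) (W : Type) [AddCommGroup W] [Module ℂ W] [FiniteDimensional ℂ W] :
    ChartedSpaceCore (GrModel a (Module.finrank ℂ W - a)) (Gr a W) where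
  atlas := Set.range grChart
  chartAt L := grChart (exists_splitting L).choose
  mem_chart_source L := by
    rw [grChart_source]
    exact ⟨0, (exists_splitting L).choose_spec⟩
  chart_mem_atlas L := ⟨_, rfl⟩
  open_source := by
    rintro _ _ ⟨g, rfl⟩ ⟨g', rfl⟩
    exact isOpen_grChart_trans_source g g'
  continuousOn_toFun := by
    rintro _ _ ⟨g, rfl⟩ ⟨g', rfl⟩
    exact (contDiffOn_grChart_trans g g').continuousOn

instance [FiniteDimensional ℂ W] : TopologicalSpace (Gr a W) := (grCore a W).toTopologicalSpace

instance [FiniteDimensional ℂ W] :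
    ChartedSpace (GrModel a (Module.finrank ℂ W - a)) (Gr a W) := (grCore a W).toChartedSpace

instance [FiniteDimensional ℂ W] :
    IsManifold 𝓘(ℂ, GrModel a (Module.finrank ℂ W - a)) ω (Gr a W) := by
  apply isManifold_of_contDiffOn
  intro e e' he he'
  obtain ⟨_, ⟨p, rfl⟩, ⟨_, ⟨⟨g, rfl⟩, rfl⟩, rfl⟩⟩ := he
  obtain ⟨_, ⟨p', rfl⟩, ⟨_, ⟨⟨g', rfl⟩, rfl⟩, rfl⟩⟩ := he'
  have h := contDiffOn_grChart_trans g g'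
  refine h.congr_mono (fun A _ => rfl) ?_
  intro A hA
  exact hA.1

end Grassmannian

/-! Projective spaces as complex manifolds, through the bijection between points of the
projective space and one-dimensional subspaces. -/

section Projective

variable {W : Type} [AddCommGroup W] [Module ℂ W] [FiniteDimensional ℂ W]

/-- The bijection between the projective space of `W` and the lines of `W`. -/
def projEquiv (W : Type) [AddCommGroup W] [Module ℂ W] : ℙ ℂ W ≃ Gr 1 W :=
  Projectivization.equivSubmodule ℂ W

instance : TopologicalSpace (ℙ ℂ W) := TopologicalSpace.induced (projEquiv W) inferInstance

/-- The bijection between the projective space of `W` and the lines of `W`, as a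
homeomorphism. -/
def projHomeo (W : Type) [AddCommGroup W] [Module ℂ W] [FiniteDimensional ℂ W] :
    ℙ ℂ W ≃ₜ Gr 1 W :=
  (projEquiv W).toHomeomorphOfIsInducing ⟨rfl⟩

instance : ChartedSpace (GrModel 1 (Module.finrank ℂ W - 1)) (ℙ ℂ W) where
  atlas := (fun e => (projHomeo W).toOpenPartialHomeomorph.trans e) ''
    atlas (GrModel 1 (Module.finrank ℂ W - 1)) (Gr 1 W)
  chartAt p := (projHomeo W).toOpenPartialHomeomorph.trans (chartAt _ (projHomeo W p))
  mem_chart_source p := by simp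
  chart_mem_atlas p := ⟨_, chart_mem_atlas _ _, rfl⟩

instance : IsManifold 𝓘(ℂ, GrModel 1 (Module.finrank ℂ W - 1)) ω (ℙ ℂ W) := by
  apply isManifold_of_contDiffOn
  rintro _ _ ⟨e, he, rfl⟩ ⟨e', he', rfl⟩
  have h := (contDiffGroupoid ω 𝓘(ℂ, GrModel 1 (Module.finrank ℂ W - 1))).compatible he he'
  rw [contDiffGroupoid, mem_groupoid_of_pregroupoid] at h
  have h1 := h.1
  refine ContDiffOn.congr_mono h1 ?_ ?_
  · intro A hA
    simp
  · intro A hA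
    simpa using hA

end Projective

section Product

variable {ι : Type} [Fintype ι] {E : ι → Type} [∀ i, NormedAddCommGroup (E i)]
  [∀ i, NormedSpace ℂ (E i)] {X : ι → Type} [∀ i, TopologicalSpace (X i)]
  [∀ i, ChartedSpace (E i) (X i)]

/-- A finite product of complex manifolds is a complex manifold. -/
instance [∀ i, IsManifold 𝓘(ℂ, E i) ω (X i)] :
    IsManifold (ModelWithCorners.pi fun i => 𝓘(ℂ, E i)) ω (∀ i, X i) := by
  apply isManifold_of_contDiffOn
  rintro _ _ ⟨e, he, rfl⟩ ⟨e', he', rfl⟩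
  have h : ∀ i, ContDiffOn ℂ ω ((e i).symm.trans (e' i)) ((e i).symm.trans (e' i)).source := by
    intro i
    have hi := (contDiffGroupoid ω 𝓘(ℂ, E i)).compatible (he i (Set.mem_univ i))
      (he' i (Set.mem_univ i))
    rw [contDiffGroupoid, mem_groupoid_of_pregroupoid] at hi
    refine hi.1.congr_mono (fun A _ => rfl) ?_
    intro A hA
    simpa using hA
  refine contDiffOn_pi.2 fun i => ?_
  refine ContDiffOn.congr_mono
    ((h i).comp (t := ((e i).symm.trans (e' i)).source)
      (s := {A : ∀ i, E i | A i ∈ ((e i).symm.trans (e' i)).source})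
      (ContinuousLinearMap.proj (R := ℂ) (φ := E) i).contDiff.contDiffOn (fun A hA => hA)) (fun A _ => rfl) ?_
  intro A hA
  exact ⟨hA.1.1 i trivial, hA.1.2 i trivial⟩

end Product

/-! Tangent spaces to subsets and regular points of restricted maps. -/

section Regular

variable {E H : Type} [NormedAddCommGroup E] [NormedSpace ℂ E] [TopologicalSpace H]
  {E' H' : Type} [NormedAddCommGroup E'] [NormedSpace ℂ E'] [TopologicalSpace H']
  {X : Type} [TopologicalSpace X] [ChartedSpace H X]
  {Y : Type} [TopologicalSpace Y] [ChartedSpace H' Y]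

/-- The tangent space at `x` to a complex submanifold `Z` of the complex manifold `X`, inside the
tangent space of `X` at `x`: the set of the velocities `γ'(0)` of the holomorphic curves `γ`, defined
near `0 ∈ ℂ`, with `γ(0) = x` and with values in `Z`. -/
def tangentSpaceOf (I : ModelWithCorners ℂ E H) (Z : Set X) (x : X) : Set (TangentSpace I x) :=
  {v | ∃ γ : ℂ → X, γ 0 = x ∧ (∀ᶠ t in 𝓝 (0 : ℂ), γ t ∈ Z) ∧
    ContMDiffAt 𝓘(ℂ, ℂ) I ω γ 0 ∧ mfderiv 𝓘(ℂ, ℂ) I γ 0 (1 : ℂ) = v}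

/-- The point `x ∈ Z` of the submanifold `Z` of `X` is a regular point of the restriction
`f : Z → Y`: the derivative of `f` maps the tangent space of `Z` at `x` onto the tangent space of
`Y` at `f x`. -/
def IsRegularPoint (I : ModelWithCorners ℂ E H) (J : ModelWithCorners ℂ E' H') (f : X → Y)
    (Z : Set X) (x : X) : Prop :=
  Set.SurjOn (mfderiv I J f x) (tangentSpaceOf I Z x) Set.univ

end Regular

/-! The interference channel. -/

/-- Parameters of an interference channel with `K` users: numbers `M` of transmit antennas, `N` of
receive antennas and `d` of streams, and the set `Φ` of the interfering links `(k, l)`, from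
transmitter `l` to receiver `k`. No relation between these numbers is imposed. -/
structure Channel where
  K : ℕ
  M : Fin K → ℕ
  N : Fin K → ℕ
  d : Fin K → ℕ
  Φ : Finset (Fin K × Fin K)

namespace Channel

variable (P : Channel)

/-- The receivers which suffer interference. -/
def ΦR : Finset (Fin P.K) := P.Φ.image Prod.fst

/-- The transmitters which cause interference. -/
def ΦT : Finset (Fin P.K) := P.Φ.image Prod.snd

/-- The receiver of an interfering link. -/
def rx (p : P.Φ) : P.ΦR := ⟨p.1.1, Finset.mem_image_of_mem _ p.2⟩

/-- The transmitter of an interfering link. -/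
def tx (p : P.Φ) : P.ΦT := ⟨p.1.2, Finset.mem_image_of_mem _ p.2⟩

/-- Channel matrices of the link `p = (k, l)`. -/
abbrev ChMat (p : P.Φ) : Type := Matrix (Fin (P.N (P.rx p))) (Fin (P.M (P.tx p))) ℂ

/-- The input space: one projective channel matrix for each interfering link. -/
abbrev InputSpace : Type := ∀ p : P.Φ, ℙ ℂ (P.ChMat p)

/-- The product of the Grassmannians of the decoders. -/
abbrev DecoderSpace : Type := ∀ k : P.ΦR, Gr (P.d k) (Fin (P.N k) → ℂ)

/-- The product of the Grassmannians of the precoders. -/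
abbrev PrecoderSpace : Type := ∀ l : P.ΦT, Gr (P.d l) (Fin (P.M l) → ℂ)

/-- The output space of decoders and precoders, indexed by the receivers in `ΦR` and the transmitters
in `ΦT`. -/
abbrev OutputSpace : Type := P.DecoderSpace × P.PrecoderSpace

/-- Affine channels: one matrix for each interfering link. -/
abbrev AffInput : Type := ∀ p : P.Φ, P.ChMat p

/-- Affine decoders. -/
abbrev AffDecoder : Type := ∀ k : P.ΦR, Matrix (Fin (P.N k)) (Fin (P.d k)) ℂ

/-- Affine precoders. -/
abbrev AffPrecoder : Type := ∀ l : P.ΦT, Matrix (Fin (P.M l)) (Fin (P.d l)) ℂ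

/-- The manifold structure of the input space. -/
abbrev modelInput := ModelWithCorners.pi fun p : P.Φ =>
  𝓘(ℂ, GrModel 1 (Module.finrank ℂ (P.ChMat p) - 1))

/-- The manifold structure of the output space. -/
abbrev modelOutput :=
  (ModelWithCorners.pi fun k : P.ΦR =>
    𝓘(ℂ, GrModel (P.d k) (Module.finrank ℂ (Fin (P.N k) → ℂ) - P.d k))).prod
  (ModelWithCorners.pi fun l : P.ΦT =>
    𝓘(ℂ, GrModel (P.d l) (Module.finrank ℂ (Fin (P.M l) → ℂ) - P.d l)))

/-- `(H, U, V)` is an affine representative of `x`: each matrix `H p` is nonzero and spans the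
line `x.1 p`, and the columns of `U k`, `V l` are bases of the corresponding subspaces. -/
def IsRepresentative (H : P.AffInput) (U : P.AffDecoder) (V : P.AffPrecoder)
    (x : P.InputSpace × P.OutputSpace) : Prop :=
  (∀ p, ∃ h : H p ≠ 0, Projectivization.mk ℂ (H p) h = x.1 p) ∧
  (∀ k, Submodule.span ℂ (Set.range (U k).col) = (x.2.1 k).1) ∧
  (∀ l, Submodule.span ℂ (Set.range (V l).col) = (x.2.2 l).1)

/-- The alignment equations `U_kᵀ H_kl V_l = 0` for all interfering links `(k, l)`. -/
def Aligned (H : P.AffInput) (U : P.AffDecoder) (V : P.AffPrecoder) : Prop :=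
  ∀ p, (U (P.rx p)).transpose * H p * V (P.tx p) = 0

/-- The solution variety: the points whose affine representatives satisfy the alignment
equations (this does not depend on the representative). -/
def solutionVariety : Set (P.InputSpace × P.OutputSpace) :=
  {x | ∃ H U V, P.IsRepresentative H U V x ∧ P.Aligned H U V}

/-- The linear map `(U', V') ↦ (U'_kᵀ H_kl V_l + U_kᵀ H_kl V'_l)`. -/
def theta (H : P.AffInput) (U : P.AffDecoder) (V : P.AffPrecoder) :
    (P.AffDecoder × P.AffPrecoder) →ₗ[ℂ]
      (∀ p : P.Φ, Matrix (Fin (P.d (P.rx p))) (Fin (P.d (P.tx p))) ℂ) where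
  toFun D p := (D.1 (P.rx p)).transpose * H p * V (P.tx p) +
    (U (P.rx p)).transpose * H p * D.2 (P.tx p)
  map_add' D D' := by
    funext p
    simp only [Prod.fst_add, Prod.snd_add, Pi.add_apply, Matrix.transpose_add, Matrix.add_mul,
      Matrix.mul_add]
    abel
  map_smul' a D := by
    funext p
    simp

end Channel

end

end InterferenceAlignment

/-!
Each point of a Grassmannian is the range of an injective linear map `φ : ℂ^a → W`, and a tangent
vector at that point is a variation `φ'` of `φ`, taken modulo the linear maps with values in the
subspace (`Represents`). Holomorphic curves in the Grassmannian are the same as holomorphic curves of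
parametrizations near `0`, with matching velocities (`exists_lift_of_hasVelocity`,
`exists_hasVelocity_of_lift`); projective spaces are the case of lines. Everything is thus reduced to
curves of matrices `(H(t), U(t), V(t))` with `U(t)ᵀ H(t) V(t) = 0`.

If the point is regular, each variation `H'` of `H` is followed, modulo multiples of the `H_kl`, by
such a curve. Differentiating the equations at `0` gives `θ(U', V') = -(Uᵀ H' V)`, where the multiples
of `H_kl` disappear because `Uᵀ H V = 0` (`Channel.exists_theta_eq_of_curve`). The matrices `U_k` and
`V_l` have left inverses, so the right-hand side is arbitrary and `θ` is surjective.

Conversely, given `H'`, let `θ(U', V') = -(Uᵀ H' V)`. There are matrices `X_k`, `Y_l` of square zero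
with `X U ≡ U'` modulo the range of `U` and `Y V ≡ V'` modulo the range of `V` (`exists_shear`), and the
curve
`U(t) = (1 + tX) U`, `V(t) = (1 + tY) V`,
`H(t) = (1 - tXᵀ) (H + t (H' + Xᵀ H + H Y)) (1 - tY)`
has derivative `H'` in the channels. As `(1 - tX)` is the inverse of `1 + tX`, and likewise for `Y`,
`U(t)ᵀ H(t) V(t) = t (Uᵀ H' V + (X U)ᵀ H V + Uᵀ H (Y V)) = t (Uᵀ H' V + θ(U', V')) = 0`,
so the curve stays in the solution variety (`Channel.exists_curve_of_theta_eq`). No implicit function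
theorem is needed.
-/

namespace InterferenceAlignment

/-! ### Velocities of holomorphic curves -/

section Velocity

variable {E H : Type} [NormedAddCommGroup E] [NormedSpace ℂ E] [TopologicalSpace H]
  {E' H' : Type} [NormedAddCommGroup E'] [NormedSpace ℂ E'] [TopologicalSpace H']
  {X : Type} [TopologicalSpace X] [ChartedSpace H X]
  {Y : Type} [TopologicalSpace Y] [ChartedSpace H' Y]

/-- The curve `γ` is holomorphic near `0` and its velocity at `0` is `v`. The tangent space at `γ 0`
is the model space `E`, through the preferred chart at `γ 0`. -/
def HasVelocity (I : ModelWithCorners ℂ E H) (γ : ℂ → X) (v : E) : Prop :=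
  ContMDiffAt 𝓘(ℂ, ℂ) I ω γ 0 ∧ mfderiv 𝓘(ℂ, ℂ) I γ 0 (1 : ℂ) = v

lemma hasVelocity_iff (I : ModelWithCorners ℂ E H) (γ : ℂ → X) (v : E) :
    HasVelocity I γ v ↔ ContinuousAt γ 0 ∧ ContDiffAt ℂ ω (fun t => extChartAt I (γ 0) (γ t)) 0 ∧
      deriv (fun t => extChartAt I (γ 0) (γ t)) 0 = v := by
  have key : ContMDiffAt 𝓘(ℂ, ℂ) I ω γ 0 ↔ ContinuousAt γ 0 ∧
      ContDiffAt ℂ ω (fun t => extChartAt I (γ 0) (γ t)) 0 := by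
    rw [contMDiffAt_iff]
    rw [ModelWithCorners.range_eq_univ, contDiffWithinAt_univ]
    exact Iff.rfl
  rw [HasVelocity, key, and_assoc]
  refine and_congr_right fun h1 => and_congr_right fun h2 => ?_
  have h3 : MDifferentiableAt 𝓘(ℂ, ℂ) I γ 0 := (key.2 ⟨h1, h2⟩).mdifferentiableAt (by simp)
  have h4 : mfderiv 𝓘(ℂ, ℂ) I γ 0 (1 : ℂ) = deriv (fun t => extChartAt I (γ 0) (γ t)) 0 := by
    have h5 : fderivWithin ℂ (writtenInExtChartAt 𝓘(ℂ, ℂ) I (0 : ℂ) γ) (Set.range 𝓘(ℂ, ℂ))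
        (extChartAt 𝓘(ℂ, ℂ) (0 : ℂ) 0) = fderiv ℂ (fun t => extChartAt I (γ 0) (γ t)) 0 := by
      rw [ModelWithCorners.range_eq_univ, fderivWithin_univ]
      rfl
    exact congrArg (fun f : ℂ →L[ℂ] E => f 1) (h3.mfderiv.trans h5)
  exact ⟨fun h => h4.symm.trans h, fun h => h4.trans h⟩

lemma hasVelocity_prodMk_iff (I : ModelWithCorners ℂ E H) (J : ModelWithCorners ℂ E' H')
    (γ : ℂ → X × Y) (v : E × E') :
    HasVelocity (I.prod J) γ v ↔
      HasVelocity I (fun t => (γ t).1) v.1 ∧ HasVelocity J (fun t => (γ t).2) v.2 := by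
  have h1 : (fun t => extChartAt (I.prod J) (γ 0) (γ t)) = fun t =>
      (extChartAt I (γ 0).1 (γ t).1, extChartAt J (γ 0).2 (γ t).2) := by
    funext t
    simp
  have hc : ContinuousAt γ 0 ↔
      ContinuousAt (fun t => (γ t).1) 0 ∧ ContinuousAt (fun t => (γ t).2) 0 :=
    ⟨fun h => ⟨continuous_fst.continuousAt.comp h, continuous_snd.continuousAt.comp h⟩,
      fun h => h.1.prodMk h.2⟩
  simp only [hasVelocity_iff, hc, h1]
  constructor
  · rintro ⟨⟨c1, c2⟩, h, rfl⟩
    have d1 : ContDiffAt ℂ ω (fun t => extChartAt I (γ 0).1 (γ t).1) 0 := h.fst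
    have d2 : ContDiffAt ℂ ω (fun t => extChartAt J (γ 0).2 (γ t).2) 0 := h.snd
    have hd := ((d1.differentiableAt (by simp)).hasDerivAt.prodMk
      (d2.differentiableAt (by simp)).hasDerivAt).deriv
    exact ⟨⟨c1, d1, by rw [hd]⟩, ⟨c2, d2, by rw [hd]⟩⟩
  · rintro ⟨⟨c1, d1, e1⟩, ⟨c2, d2, e2⟩⟩
    have hd := ((d1.differentiableAt (by simp)).hasDerivAt.prodMk
      (d2.differentiableAt (by simp)).hasDerivAt).deriv
    exact ⟨⟨c1, c2⟩, d1.prodMk d2, by rw [hd, e1, e2]⟩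

lemma hasVelocity_pi_iff {ι : Type} [Fintype ι] {E : ι → Type} [∀ i, NormedAddCommGroup (E i)]
    [∀ i, NormedSpace ℂ (E i)] {H : ι → Type} [∀ i, TopologicalSpace (H i)]
    {X : ι → Type} [∀ i, TopologicalSpace (X i)] [∀ i, ChartedSpace (H i) (X i)]
    (I : ∀ i, ModelWithCorners ℂ (E i) (H i)) (γ : ℂ → ∀ i, X i) (v : ∀ i, E i) :
    HasVelocity (ModelWithCorners.pi I) γ v ↔
      ∀ i, HasVelocity (I i) (fun t => γ t i) (v i) := by
  have h1 : (fun t => extChartAt (ModelWithCorners.pi I) (γ 0) (γ t)) = fun t i =>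
      extChartAt (I i) (γ 0 i) (γ t i) := rfl
  simp only [hasVelocity_iff, h1]
  constructor
  · rintro ⟨c, d, rfl⟩ i
    have d' := contDiffAt_pi.1 d
    exact ⟨continuousAt_pi.1 c i, d' i, by
      rw [deriv_pi fun i => (d' i).differentiableAt (by simp)]⟩
  · intro h
    refine ⟨continuousAt_pi.2 fun i => (h i).1, contDiffAt_pi.2 fun i => (h i).2.1, ?_⟩
    rw [deriv_pi fun i => (h i).2.1.differentiableAt (by simp)]
    exact funext fun i => (h i).2.2

/-- A point is regular for the projection of `Z` to the first factor exactly when each tangent vector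
of that factor is the velocity of the first component of a holomorphic curve in `Z`. -/
lemma isRegularPoint_fst_iff (I : ModelWithCorners ℂ E H) (J : ModelWithCorners ℂ E' H')
    (Z : Set (X × Y)) (x : X × Y) :
    IsRegularPoint (I.prod J) I Prod.fst Z x ↔
      ∀ w : E, ∃ (γ : ℂ → X × Y) (w' : E'), γ 0 = x ∧ (∀ᶠ t in 𝓝 (0 : ℂ), γ t ∈ Z) ∧
        HasVelocity I (fun t => (γ t).1) w ∧ HasVelocity J (fun t => (γ t).2) w' := by
  constructor
  · intro h w
    obtain ⟨v, ⟨γ, h0, hZ, hs, hv⟩, hw⟩ := h (Set.mem_univ (w : TangentSpace I x.1))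
    rw [mfderiv_fst] at hw
    have hγ : HasVelocity (I.prod J) γ ((v : E × E')) := by
      subst h0
      exact ⟨hs, hv⟩
    have := (hasVelocity_prodMk_iff I J γ _).1 hγ
    refine ⟨γ, _, h0, hZ, ?_, this.2⟩
    have hw' : (v : E × E').1 = w := hw
    rw [← hw']
    exact this.1
  · intro h w _
    obtain ⟨γ, w', h0, hZ, h1, h2⟩ := h w
    have hγ := (hasVelocity_prodMk_iff I J γ ((w, w') : E × E')).2 ⟨h1, h2⟩
    refine ⟨((w, w') : E × E'), ⟨γ, h0, hZ, hγ.1, ?_⟩, ?_⟩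
    · subst h0
      exact hγ.2
    · rw [mfderiv_fst]
      rfl

end Velocity

/-! ### Curves in Grassmannians -/

section GrassmannianCurves

variable {a : ℕ} {W : Type} [AddCommGroup W] [Module ℂ W] [FiniteDimensional ℂ W]

/-- The splitting of `W` which defines the preferred chart of the Grassmannian at `L`. -/
noncomputable def grSplitting (L : Gr a W) :
    ((Fin a → ℂ) × (Fin (Module.finrank ℂ W - a) → ℂ)) ≃ₗ[ℂ] W :=
  (exists_splitting L).choose

lemma grGraph_grSplitting (L : Gr a W) : grGraph (grSplitting L) 0 = L :=
  (exists_splitting L).choose_spec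

lemma mem_iff_snd_eq_zero (L : Gr a W) (w : W) : w ∈ L.1 ↔ ((grSplitting L).symm w).2 = 0 := by
  conv_lhs => rw [← grGraph_grSplitting L]
  constructor
  · rintro ⟨y, rfl⟩
    simp [graphMap_apply]
  · intro h
    refine ⟨((grSplitting L).symm w).1, ?_⟩
    rw [graphMap_apply, zero_apply, ← h]
    exact (grSplitting L).apply_symm_apply w

/-- The tangent vector `v` of the Grassmannian at `L`, read in the preferred chart, is the class
modulo `L` of the variation `F'` of the parametrization `φ : ℂ^a → W` of `L`. -/
def Represents (L : Gr a W) (φ F' : (Fin a → ℂ) →ₗ[ℂ] W)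
    (v : GrModel a (Module.finrank ℂ W - a)) : Prop :=
  ∀ y, ((grSplitting L).symm (F' y)).2 = v ((grSplitting L).symm (φ y)).1

lemma fst_comp_bijective (L : Gr a W) (φ : (Fin a → ℂ) →ₗ[ℂ] W) (hφ : LinearMap.range φ = L.1) :
    Function.Bijective (LinearMap.fst ℂ _ _ ∘ₗ (grSplitting L).symm.toLinearMap ∘ₗ φ) := by
  have hs : Function.Surjective
      (LinearMap.fst ℂ _ _ ∘ₗ (grSplitting L).symm.toLinearMap ∘ₗ φ) := by
    intro z
    have hz : grSplitting L (z, 0) ∈ L.1 := by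
      rw [mem_iff_snd_eq_zero]
      simp
    rw [← hφ] at hz
    obtain ⟨y, hy⟩ := hz
    exact ⟨y, by simp [hy]⟩
  exact ⟨LinearMap.injective_iff_surjective.2 hs, hs⟩

/-- Every variation of a parametrization of `L` represents a tangent vector. -/
lemma exists_represents (L : Gr a W) (φ F' : (Fin a → ℂ) →ₗ[ℂ] W)
    (hφ : LinearMap.range φ = L.1) : ∃ v, Represents L φ F' v := by
  let R := LinearEquiv.ofBijective _ (fst_comp_bijective L φ hφ)
  refine ⟨LinearMap.toContinuousLinearMap
    (LinearMap.snd ℂ _ _ ∘ₗ (grSplitting L).symm.toLinearMap ∘ₗ F' ∘ₗ R.symm.toLinearMap), ?_⟩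
  intro y
  have h : R.symm ((grSplitting L).symm (φ y)).1 = y := R.symm_apply_apply y
  simp [h]

/-- The variation which represents `v` and takes its values in the complement of `L` given by the
splitting. -/
noncomputable def grLift (L : Gr a W) (φ : (Fin a → ℂ) →ₗ[ℂ] W)
    (v : GrModel a (Module.finrank ℂ W - a)) :
    (Fin a → ℂ) →ₗ[ℂ] W :=
  (grSplitting L).toLinearMap ∘ₗ LinearMap.inr ℂ _ _ ∘ₗ v.toLinearMap ∘ₗ
    LinearMap.fst ℂ _ _ ∘ₗ (grSplitting L).symm.toLinearMap ∘ₗ φ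

lemma represents_grLift (L : Gr a W) (φ : (Fin a → ℂ) →ₗ[ℂ] W)
    (v : GrModel a (Module.finrank ℂ W - a)) : Represents L φ (grLift L φ v) v := by
  intro y
  simp [grLift]

lemma Represents.sub_mem {L : Gr a W} {φ F' F'' : (Fin a → ℂ) →ₗ[ℂ] W}
    {v : GrModel a (Module.finrank ℂ W - a)} (h' : Represents L φ F' v)
    (h'' : Represents L φ F'' v) (y : Fin a → ℂ) : F' y - F'' y ∈ L.1 := by
  rw [mem_iff_snd_eq_zero, map_sub, Prod.snd_sub, h' y, h'' y, sub_self]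

/-- A holomorphic curve in the Grassmannian lifts to a holomorphic curve of parametrizations, with
prescribed value at `0`, and the derivative of the lift represents the velocity of the curve. -/
lemma exists_lift_of_hasVelocity (γ : ℂ → Gr a W) (v : GrModel a (Module.finrank ℂ W - a))
    (hγ : HasVelocity 𝓘(ℂ, GrModel a (Module.finrank ℂ W - a)) γ v)
    (φ : (Fin a → ℂ) →ₗ[ℂ] W) (hφ : LinearMap.range φ = (γ 0).1) :
    ∃ (F : ℂ → (Fin a → ℂ) →ₗ[ℂ] W) (F' : (Fin a → ℂ) →ₗ[ℂ] W), F 0 = φ ∧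
      Represents (γ 0) φ F' v ∧ (∀ᶠ t in 𝓝 (0 : ℂ), ∀ y, F t y ∈ (γ t).1) ∧
      ∀ (f : W →ₗ[ℂ] ℂ) y, HasDerivAt (fun t => f (F t y)) (f (F' y)) 0 := by
  obtain ⟨hc, hd, hv⟩ := (hasVelocity_iff _ _ _).1 hγ
  set g := grSplitting (γ 0) with hg
  let A : ℂ → GrModel a (Module.finrank ℂ W - a) := fun t => grChart g (γ t)
  have hA : HasDerivAt A v 0 := by
    rw [← hv]
    exact (hd.differentiableAt (by simp)).hasDerivAt
  have hsrc : ∀ᶠ t in 𝓝 (0 : ℂ), γ t ∈ (grChart g).source :=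
    hc.eventually_mem (chart_source_mem_nhds (GrModel a (Module.finrank ℂ W - a)) (γ 0))
  have hA0 : A 0 = 0 := by
    change grChart g (γ 0) = 0
    conv_lhs => rw [← grGraph_grSplitting (γ 0)]
    exact grChart_grGraph g 0
  let R : (Fin a → ℂ) →ₗ[ℂ] (Fin a → ℂ) := LinearMap.fst ℂ _ _ ∘ₗ g.symm.toLinearMap ∘ₗ φ
  refine ⟨fun t => graphMap g (A t) ∘ₗ R, grLift (γ 0) φ v, ?_, represents_grLift _ _ _, ?_, ?_⟩
  · ext1 j
    apply LinearMap.ext_ring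
    have h : φ (LinearMap.single ℂ (fun _ => ℂ) j 1) ∈ (γ 0).1 := hφ ▸ ⟨_, rfl⟩
    rw [mem_iff_snd_eq_zero] at h
    simp only [LinearMap.comp_apply, hA0, graphMap_apply, zero_apply]
    apply g.symm.injective
    rw [g.symm_apply_apply]
    exact Prod.ext rfl h.symm
  · filter_upwards [hsrc] with t ht y
    rw [grChart_source] at ht
    obtain ⟨B, hB⟩ := ht
    have hAB : A t = B := by
      change grChart g (γ t) = B
      rw [← hB, grChart_grGraph]
    rw [hAB, ← hB]
    exact ⟨R y, rfl⟩
  · intro f y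
    have h1 : HasDerivAt (fun t => A t (R y)) (v (R y)) 0 := by
      simpa using hA.clm_apply (hasDerivAt_const (0 : ℂ) (R y))
    let ℓ : (Fin (Module.finrank ℂ W - a) → ℂ) →L[ℂ] ℂ :=
      LinearMap.toContinuousLinearMap (f ∘ₗ g.toLinearMap ∘ₗ LinearMap.inr ℂ _ _)
    have h2 := (ℓ.hasFDerivAt.comp_hasDerivAt (0 : ℂ) h1).const_add (f (g (R y, 0)))
    refine h2.congr_of_eventuallyEq (Filter.Eventually.of_forall fun t => ?_)
    change f (g (R y, A t (R y))) = f (g (R y, 0)) + f (g (0, A t (R y)))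
    rw [← map_add, ← map_add]
    simp

/-- A holomorphic curve of linear maps whose value at `0` parametrizes `L` defines, near `0`, a
holomorphic curve in the Grassmannian. -/
lemma exists_hasVelocity_of_lift (L : Gr a W) (F : ℂ → (Fin a → ℂ) →ₗ[ℂ] W)
    (F' : (Fin a → ℂ) →ₗ[ℂ] W) (v : GrModel a (Module.finrank ℂ W - a))
    (h0 : LinearMap.range (F 0) = L.1)
    (hF : ∀ (f : W →ₗ[ℂ] ℂ) y, ContDiff ℂ ω (fun t => f (F t y)))
    (hF' : ∀ (f : W →ₗ[ℂ] ℂ) y, HasDerivAt (fun t => f (F t y)) (f (F' y)) 0)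
    (hv : Represents L (F 0) F' v) :
    ∃ γ : ℂ → Gr a W, γ 0 = L ∧ (∀ᶠ t in 𝓝 (0 : ℂ), LinearMap.range (F t) = (γ t).1) ∧
      HasVelocity 𝓘(ℂ, GrModel a (Module.finrank ℂ W - a)) γ v := by
  set g := grSplitting L with hg
  let F1 : ℂ → (Fin a → ℂ) →L[ℂ] (Fin a → ℂ) := fun t =>
    LinearMap.toContinuousLinearMap (LinearMap.fst ℂ _ _ ∘ₗ g.symm.toLinearMap ∘ₗ F t)
  let F2 : ℂ → GrModel a (Module.finrank ℂ W - a) := fun t =>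
    LinearMap.toContinuousLinearMap (LinearMap.snd ℂ _ _ ∘ₗ g.symm.toLinearMap ∘ₗ F t)
  have hF12 : ∀ t y, g (F1 t y, F2 t y) = F t y := fun t y => g.apply_symm_apply _
  have hF1 : ContDiff ℂ ω F1 := contDiff_clm_apply_iff.2 fun y => contDiff_pi.2 fun j =>
    hF (LinearMap.proj j ∘ₗ LinearMap.fst ℂ _ _ ∘ₗ g.symm.toLinearMap) y
  have hF2 : ContDiff ℂ ω F2 := contDiff_clm_apply_iff.2 fun y => contDiff_pi.2 fun j =>
    hF (LinearMap.proj j ∘ₗ LinearMap.snd ℂ _ _ ∘ₗ g.symm.toLinearMap) y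
  have hu : IsUnit (F1 0) := by
    obtain ⟨e, he⟩ := (Module.End.isUnit_iff _).2 (fst_comp_bijective L (F 0) h0)
    have h1 : ∀ y, F1 0 ((e⁻¹).val y) = y := fun y => by
      have := DFunLike.congr_fun e.mul_inv y
      rw [he] at this
      exact this
    have h2 : ∀ y, (e⁻¹).val (F1 0 y) = y := fun y => by
      have := DFunLike.congr_fun e.inv_mul y
      rw [he] at this
      exact this
    exact ⟨⟨F1 0, LinearMap.toContinuousLinearMap (e⁻¹).val,
      ContinuousLinearMap.ext h1, ContinuousLinearMap.ext h2⟩, rfl⟩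
  have hF20 : F2 0 = 0 := by
    ext1 y
    have h : F 0 y ∈ L.1 := h0 ▸ ⟨y, rfl⟩
    exact (mem_iff_snd_eq_zero L _).1 h
  have hinv : ContDiffAt ℂ ω (fun t => Ring.inverse (F1 t)) 0 := by
    obtain ⟨u, hu⟩ := hu
    have h2 : ContDiffAt ℂ ω Ring.inverse (F1 0) := by
      rw [← hu]
      exact contDiffAt_ringInverse ℂ u
    exact h2.comp (0 : ℂ) hF1.contDiffAt
  -- The chart reads the range of `F t` as `F2 t ∘ (F1 t)⁻¹`. Where `F1 t` is not invertible the
  -- value of `Ring.inverse` is `0`, but this does not happen for `t` near `0`.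
  let A : ℂ → GrModel a (Module.finrank ℂ W - a) := fun t => F2 t ∘L Ring.inverse (F1 t)
  have hA : ContDiffAt ℂ ω A 0 := hF2.contDiffAt.clm_comp hinv
  have hA0 : A 0 = 0 := by
    change F2 0 ∘L Ring.inverse (F1 0) = 0
    rw [hF20, ContinuousLinearMap.zero_comp]
  have hγ0 : grGraph g (A 0) = L := by rw [hA0]; exact grGraph_grSplitting L
  have hA' : HasDerivAt A v 0 := by
    have d2 := (hF2.contDiffAt.differentiableAt (by simp) (x := (0 : ℂ))).hasDerivAt
    have d1 := (hinv.differentiableAt (by simp)).hasDerivAt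
    have d := d2.clm_comp d1
    rw [hF20, ContinuousLinearMap.zero_comp, add_zero] at d
    have hd2 : deriv F2 0 = v ∘L F1 0 := by
      ext1 y
      have e1 : HasDerivAt (fun t => F2 t y) (deriv F2 0 y) 0 := by
        simpa using d2.clm_apply (hasDerivAt_const (0 : ℂ) y)
      have e2 : HasDerivAt (fun t => F2 t y) ((g.symm (F' y)).2) 0 :=
        hasDerivAt_pi.2 fun j =>
          hF' (LinearMap.proj j ∘ₗ LinearMap.snd ℂ _ _ ∘ₗ g.symm.toLinearMap) y
      rw [e1.unique e2]
      exact hv y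
    have hv' : deriv F2 0 ∘L Ring.inverse (F1 0) = v := by
      rw [hd2, ContinuousLinearMap.comp_assoc]
      exact congrArg (v ∘L ·) (Ring.mul_inverse_cancel _ hu)
    exact hv' ▸ d
  refine ⟨fun t => grGraph g (A t), hγ0, ?_, ?_⟩
  · have hopen : ∀ᶠ t in 𝓝 (0 : ℂ), IsUnit (F1 t) :=
      hF1.continuous.continuousAt.eventually_mem (Units.isOpen.mem_nhds hu)
    filter_upwards [hopen] with t ht
    have h1 : ∀ y, Ring.inverse (F1 t) (F1 t y) = y := fun y =>
      DFunLike.congr_fun (Ring.inverse_mul_cancel _ ht) y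
    have h2 : ∀ y, F1 t (Ring.inverse (F1 t) y) = y := fun y =>
      DFunLike.congr_fun (Ring.mul_inverse_cancel _ ht) y
    apply le_antisymm
    · rintro _ ⟨y, rfl⟩
      refine ⟨F1 t y, ?_⟩
      rw [graphMap_apply, ContinuousLinearMap.comp_apply, h1, hF12]
    · rintro _ ⟨y, rfl⟩
      refine ⟨Ring.inverse (F1 t) y, ?_⟩
      rw [graphMap_apply, ContinuousLinearMap.comp_apply, ← hF12, h2]
  · have hch : (fun t => extChartAt 𝓘(ℂ, GrModel a (Module.finrank ℂ W - a))
        (grGraph g (A 0)) (grGraph g (A t))) = A := by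
      funext t
      rw [hγ0]
      exact grChart_grGraph g (A t)
    rw [hasVelocity_iff, hch]
    refine ⟨?_, hA, hA'.deriv⟩
    have hs := continuousOn_extChartAt_symm (I := 𝓘(ℂ, GrModel a (Module.finrank ℂ W - a))) L
    have hmem : A 0 ∈ (extChartAt 𝓘(ℂ, GrModel a (Module.finrank ℂ W - a)) L).target := by
      rw [extChartAt_target]
      exact ⟨Set.mem_univ _, Set.mem_range_self _⟩
    have hs' := hs.continuousAt ((isOpen_extChartAt_target L).mem_nhds hmem)
    exact hs'.comp (f := A) (x := (0 : ℂ)) hA.continuousAt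

end GrassmannianCurves

/-! ### Curves in projective spaces -/

section ProjectiveCurves

variable {W : Type} [AddCommGroup W] [Module ℂ W]

/-- The parametrization `y ↦ y 0 • w` of the line spanned by `w`, by vectors with one coordinate. -/
noncomputable def lineParam (w : W) : (Fin 1 → ℂ) →ₗ[ℂ] W :=
  LinearMap.toSpanSingleton ℂ W w ∘ₗ LinearMap.proj 0

lemma lineParam_apply (w : W) (y : Fin 1 → ℂ) : lineParam w y = y 0 • w := rfl

lemma lineParam_eval_one (F : (Fin 1 → ℂ) →ₗ[ℂ] W) : lineParam (F 1) = F := by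
  ext1 j
  apply LinearMap.ext_ring
  rw [Subsingleton.elim j 0]
  have h : (1 : Fin 1 → ℂ) = Pi.single 0 1 := by
    funext i
    rw [Subsingleton.elim i 0]
    simp
  simp [lineParam_apply, h]

lemma range_lineParam (w : W) : LinearMap.range (lineParam w) = ℂ ∙ w := by
  apply le_antisymm
  · rintro _ ⟨y, rfl⟩
    exact Submodule.smul_mem _ _ (Submodule.mem_span_singleton_self w)
  · rw [Submodule.span_singleton_le_iff_mem]
    exact ⟨1, by simp [lineParam_apply]⟩

lemma projEquiv_mk (w : W) (h : w ≠ 0) : (projEquiv W (Projectivization.mk ℂ w h)).1 = ℂ ∙ w :=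
  Projectivization.submodule_mk w h

variable [FiniteDimensional ℂ W]

lemma hasVelocity_proj_iff (γ : ℂ → ℙ ℂ W) (v : GrModel 1 (Module.finrank ℂ W - 1)) :
    HasVelocity 𝓘(ℂ, GrModel 1 (Module.finrank ℂ W - 1)) γ v ↔
      HasVelocity 𝓘(ℂ, GrModel 1 (Module.finrank ℂ W - 1)) (fun t => projEquiv W (γ t)) v := by
  rw [hasVelocity_iff, hasVelocity_iff]
  exact and_congr_left fun _ => (projHomeo W).isInducing.continuousAt_iff

/-- A holomorphic curve in the projective space lifts to a holomorphic curve of vectors. -/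
lemma exists_vector_lift (γ : ℂ → ℙ ℂ W) (v : GrModel 1 (Module.finrank ℂ W - 1))
    (hγ : HasVelocity 𝓘(ℂ, GrModel 1 (Module.finrank ℂ W - 1)) γ v)
    (w : W) (hw : w ≠ 0) (h0 : Projectivization.mk ℂ w hw = γ 0) :
    ∃ (c : ℂ → W) (w' : W), c 0 = w ∧
      Represents (projEquiv W (γ 0)) (lineParam w) (lineParam w') v ∧
      (∀ᶠ t in 𝓝 (0 : ℂ), c t ∈ (projEquiv W (γ t)).1) ∧
      ∀ f : W →ₗ[ℂ] ℂ, HasDerivAt (fun t => f (c t)) (f w') 0 := by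
  obtain ⟨F, F', hF0, hv, hmem, hd⟩ := exists_lift_of_hasVelocity _ v
    ((hasVelocity_proj_iff γ v).1 hγ) (lineParam w) (by
      rw [range_lineParam, ← h0, projEquiv_mk])
  refine ⟨fun t => F t 1, F' 1, by simp [hF0, lineParam_apply], ?_,
    hmem.mono fun t ht => ht 1, fun f => hd f 1⟩
  rw [lineParam_eval_one]
  exact hv

/-- A holomorphic curve of vectors, nonzero at `0`, defines near `0` a holomorphic curve in the
projective space. -/
lemma exists_hasVelocity_of_vector_lift (p : ℙ ℂ W) (c : ℂ → W) (w' : W)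
    (v : GrModel 1 (Module.finrank ℂ W - 1)) (hw : c 0 ≠ 0)
    (h0 : Projectivization.mk ℂ (c 0) hw = p)
    (hc : ∀ f : W →ₗ[ℂ] ℂ, ContDiff ℂ ω (fun t => f (c t)))
    (hc' : ∀ f : W →ₗ[ℂ] ℂ, HasDerivAt (fun t => f (c t)) (f w') 0)
    (hv : Represents (projEquiv W p) (lineParam (c 0)) (lineParam w') v) :
    ∃ γ : ℂ → ℙ ℂ W, γ 0 = p ∧
      (∀ᶠ t in 𝓝 (0 : ℂ), ∃ h : c t ≠ 0, Projectivization.mk ℂ (c t) h = γ t) ∧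
      HasVelocity 𝓘(ℂ, GrModel 1 (Module.finrank ℂ W - 1)) γ v := by
  obtain ⟨γ, hγ0, hγ, hγv⟩ := exists_hasVelocity_of_lift (projEquiv W p)
    (fun t => lineParam (c t)) (lineParam w') v
    (by rw [range_lineParam, ← h0, projEquiv_mk])
    (fun f y => by simpa [lineParam_apply] using hc (y 0 • f))
    (fun f y => by simpa [lineParam_apply] using hc' (y 0 • f)) hv
  refine ⟨fun t => (projEquiv W).symm (γ t), by simp [hγ0], ?_, ?_⟩
  · filter_upwards [hγ] with t ht
    rw [range_lineParam] at ht
    have hne : c t ≠ 0 := by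
      intro h
      have h1 := (γ t).2
      rw [← ht, h, Submodule.span_zero_singleton, finrank_bot] at h1
      exact zero_ne_one h1
    refine ⟨hne, ?_⟩
    rw [Equiv.eq_symm_apply]
    exact Subtype.ext ((projEquiv_mk _ hne).trans ht)
  · rw [hasVelocity_proj_iff]
    simpa using hγv

end ProjectiveCurves

/-! ### Products and left inverses of matrices -/

section MatrixCurves

variable {m n r s : ℕ}

/-- The derivative of a product of three matrices, entry by entry. -/
lemma hasDerivAt_transpose_mul_mul {A : ℂ → Matrix (Fin n) (Fin m) ℂ}
    {B : ℂ → Matrix (Fin n) (Fin r) ℂ} {C : ℂ → Matrix (Fin r) (Fin s) ℂ}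
    {A' : Matrix (Fin n) (Fin m) ℂ} {B' : Matrix (Fin n) (Fin r) ℂ} {C' : Matrix (Fin r) (Fin s) ℂ}
    (hA : ∀ i j, HasDerivAt (fun t => A t i j) (A' i j) 0)
    (hB : ∀ i j, HasDerivAt (fun t => B t i j) (B' i j) 0)
    (hC : ∀ i j, HasDerivAt (fun t => C t i j) (C' i j) 0) (i : Fin m) (j : Fin s) :
    HasDerivAt (fun t => ((A t).transpose * B t * C t) i j)
      ((A'.transpose * B 0 * C 0 + (A 0).transpose * B' * C 0 +
        (A 0).transpose * B 0 * C') i j) 0 := by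
  simp only [Matrix.mul_apply, Matrix.add_apply, Matrix.transpose_apply]
  have h := HasDerivAt.fun_sum (u := Finset.univ) fun k _ =>
    (HasDerivAt.fun_sum (u := Finset.univ) fun l _ => (hA l i).mul (hB l k)).mul (hC k j)
  refine h.congr_deriv ?_
  rw [← Finset.sum_add_distrib, ← Finset.sum_add_distrib]
  refine Finset.sum_congr rfl fun k _ => ?_
  rw [Finset.sum_add_distrib, add_mul]
  rfl

/-- A matrix whose columns span a space of dimension their number has a left inverse. -/
lemma exists_left_inverse (A : Matrix (Fin n) (Fin m) ℂ)
    (hA : Module.finrank ℂ (Submodule.span ℂ (Set.range A.col)) = m) :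
    ∃ B : Matrix (Fin m) (Fin n) ℂ, B * A = 1 := by
  have hker : LinearMap.ker A.mulVecLin = ⊥ := by
    have h := LinearMap.finrank_range_add_finrank_ker A.mulVecLin
    rw [Matrix.range_mulVecLin, hA, Module.finrank_fin_fun] at h
    exact Submodule.finrank_eq_zero.1 (by omega)
  obtain ⟨g, hg⟩ := A.mulVecLin.exists_leftInverse_of_injective hker
  refine ⟨LinearMap.toMatrix' g, ?_⟩
  have h := congrArg LinearMap.toMatrix' hg
  rwa [LinearMap.toMatrix'_comp, LinearMap.toMatrix'_id, ← Matrix.toLin'_apply',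
    LinearMap.toMatrix'_toLin'] at h

/-- A matrix with columns in the span of the columns of `A` is a right multiple of `A`. -/
lemma exists_eq_mul_of_col_mem (A : Matrix (Fin n) (Fin m) ℂ) (B : Matrix (Fin n) (Fin r) ℂ)
    (hB : ∀ j, B.col j ∈ Submodule.span ℂ (Set.range A.col)) :
    ∃ S : Matrix (Fin m) (Fin r) ℂ, B = A * S := by
  simp only [← Matrix.range_mulVecLin, LinearMap.mem_range, Matrix.mulVecLin_apply] at hB
  choose S hS using hB
  refine ⟨(Matrix.of S).transpose, ?_⟩
  ext i j
  exact (congrFun (hS j) i).symm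

end MatrixCurves

/-! ### Cubic curves -/

section Cubic

variable {W : Type} [AddCommGroup W] [Module ℂ W]

lemma contDiff_cubic (w w₁ w₂ w₃ : W) (f : W →ₗ[ℂ] ℂ) :
    ContDiff ℂ ω (fun t : ℂ => f (w + t • w₁ + t ^ 2 • w₂ + t ^ 3 • w₃)) := by
  simp only [map_add, map_smul, smul_eq_mul]
  fun_prop

lemma hasDerivAt_cubic (w w₁ w₂ w₃ : W) (f : W →ₗ[ℂ] ℂ) :
    HasDerivAt (fun t : ℂ => f (w + t • w₁ + t ^ 2 • w₂ + t ^ 3 • w₃)) (f w₁) 0 := by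
  simp only [map_add, map_smul, smul_eq_mul]
  have h := (((hasDerivAt_const (0 : ℂ) (f w)).add ((hasDerivAt_id (0 : ℂ)).mul_const (f w₁))).add
    (((hasDerivAt_id (0 : ℂ)).pow 2).mul_const (f w₂))).add
    (((hasDerivAt_id (0 : ℂ)).pow 3).mul_const (f w₃))
  refine h.congr_deriv ?_
  simp

end Cubic

/-! ### Shears of square zero -/

section Shear

variable {m n r s : ℕ}

/-- For `X`, `Y` of square zero, the inverses of `1 + tX`, `1 + tY` are `1 - tX`, `1 - tY`, so that
`(1 - tXᵀ) G (1 - tY)` is the contragredient motion of `G`: its pairing with the moved matrices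
`(1 + tX) U`, `(1 + tY) V` is that of `G` with `U`, `V`. -/
lemma shear_pairing {X : Matrix (Fin n) (Fin n) ℂ} {Y : Matrix (Fin r) (Fin r) ℂ}
    (hX : X * X = 0) (hY : Y * Y = 0) (U : Matrix (Fin n) (Fin m) ℂ)
    (V : Matrix (Fin r) (Fin s) ℂ) (G : Matrix (Fin n) (Fin r) ℂ) (t : ℂ) :
    ((1 + t • X) * U).transpose * ((1 - t • X.transpose) * G * (1 - t • Y)) * ((1 + t • Y) * V) =
      U.transpose * G * V := by
  have hX' : X.transpose * X.transpose = 0 := by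
    rw [← Matrix.transpose_mul, hX, Matrix.transpose_zero]
  have h1 : (1 + t • X).transpose * (1 - t • X.transpose) = 1 := by
    simp [Matrix.add_mul, Matrix.mul_sub, hX']
  have h2 : (1 - t • Y) * (1 + t • Y) = 1 := by
    simp [Matrix.sub_mul, Matrix.mul_add, hY]
  calc _ = U.transpose * ((1 + t • X).transpose * (1 - t • X.transpose)) * G *
        ((1 - t • Y) * (1 + t • Y)) * V := by
        simp only [Matrix.transpose_mul, Matrix.mul_assoc]
    _ = _ := by rw [h1, h2, Matrix.mul_one, Matrix.mul_one]

/-- The curve of channels is cubic in `t`, with derivative `H'` at `0`. -/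
lemma shear_expand (X : Matrix (Fin n) (Fin n) ℂ) (Y : Matrix (Fin r) (Fin r) ℂ)
    (H H' : Matrix (Fin n) (Fin r) ℂ) :
    ∃ H₂ H₃ : Matrix (Fin n) (Fin r) ℂ, ∀ t : ℂ,
      (1 - t • X.transpose) * (H + t • (H' + X.transpose * H + H * Y)) * (1 - t • Y) =
        H + t • H' + t ^ 2 • H₂ + t ^ 3 • H₃ := by
  refine ⟨X.transpose * H * Y - X.transpose * (H' + X.transpose * H + H * Y) -
    (H' + X.transpose * H + H * Y) * Y, X.transpose * (H' + X.transpose * H + H * Y) * Y,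
    fun t => ?_⟩
  simp only [Matrix.sub_mul, Matrix.mul_sub, Matrix.mul_add, Matrix.add_mul, Matrix.one_mul,
    Matrix.mul_one, Matrix.smul_mul, Matrix.mul_smul, smul_smul, smul_add, smul_sub,
    Matrix.mul_assoc]
  module

/-- Modulo matrices with columns in the range of `U`, each variation `D` of `U` comes from an
infinitesimal motion `X` of square zero: `X` maps the range of `U` to a complement, which it kills. -/
lemma exists_shear (U D : Matrix (Fin n) (Fin m) ℂ) {L : Matrix (Fin m) (Fin n) ℂ}
    (hL : L * U = 1) :
    ∃ (X : Matrix (Fin n) (Fin n) ℂ) (S : Matrix (Fin m) (Fin m) ℂ),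
      X * X = 0 ∧ X * U = D - U * S := by
  refine ⟨(D - U * (L * D)) * L, L * D, ?_, ?_⟩
  · have h : L * (D - U * (L * D)) = 0 := by
      rw [Matrix.mul_sub, ← Matrix.mul_assoc, hL, Matrix.one_mul, sub_self]
    rw [Matrix.mul_assoc, ← Matrix.mul_assoc L, h, Matrix.zero_mul, Matrix.mul_zero]
  · rw [Matrix.mul_assoc, hL, Matrix.mul_one]

/-- The motion of a subspace `L`, the span of the columns of `A`, under the linear maps `1 + tZ` is a
holomorphic curve in the Grassmannian for small `t`. -/
lemma exists_hasVelocity_motion (A : Matrix (Fin n) (Fin m) ℂ) (Z : Matrix (Fin n) (Fin n) ℂ)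
    (L : Gr m (Fin n → ℂ)) (hA : Submodule.span ℂ (Set.range A.col) = L.1) :
    ∃ (γ : ℂ → Gr m (Fin n → ℂ)) (w : GrModel m (Module.finrank ℂ (Fin n → ℂ) - m)), γ 0 = L ∧
      (∀ᶠ t in 𝓝 (0 : ℂ), Submodule.span ℂ (Set.range ((1 + t • Z) * A).col) = (γ t).1) ∧
      HasVelocity 𝓘(ℂ, GrModel m (Module.finrank ℂ (Fin n → ℂ) - m)) γ w := by
  have hlin : ∀ t : ℂ, ∀ y, ((1 + t • Z) * A).mulVecLin y =
      A.mulVecLin y + t • (Z * A).mulVecLin y + t ^ 2 • (0 : Fin n → ℂ) +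
        t ^ 3 • (0 : Fin n → ℂ) := by
    intro t y
    simp [Matrix.add_mul]
  have e : ((1 + (0 : ℂ) • Z) * A) = A := by simp
  have hr : LinearMap.range A.mulVecLin = L.1 := (Matrix.range_mulVecLin A).trans hA
  obtain ⟨w, hw⟩ := exists_represents L A.mulVecLin (Z * A).mulVecLin hr
  obtain ⟨γ, h0, hγ, hγw⟩ := exists_hasVelocity_of_lift L
    (fun t => ((1 + t • Z) * A).mulVecLin) (Z * A).mulVecLin w (by rw [e, hr])
    (fun f y => by simpa only [hlin] using contDiff_cubic _ _ _ _ f)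
    (fun f y => by simpa only [hlin] using hasDerivAt_cubic _ _ _ _ f)
    (by simpa only [e] using hw)
  exact ⟨γ, w, h0, hγ.mono fun t ht => (Matrix.range_mulVecLin _).symm.trans ht, hγw⟩

end Shear

/-! ### Curves in the solution variety -/

namespace Channel

variable (P : Channel) {x : P.InputSpace × P.OutputSpace} {H : P.AffInput} {U : P.AffDecoder}
  {V : P.AffPrecoder}

lemma exists_left_inverse_decoder (hrep : P.IsRepresentative H U V x) (k : P.ΦR) :
    ∃ L : Matrix (Fin (P.d k)) (Fin (P.N k)) ℂ, L * U k = 1 :=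
  exists_left_inverse (U k) (by rw [hrep.2.1 k]; exact (x.2.1 k).2)

lemma exists_left_inverse_precoder (hrep : P.IsRepresentative H U V x) (l : P.ΦT) :
    ∃ L : Matrix (Fin (P.d l)) (Fin (P.M l)) ℂ, L * V l = 1 :=
  exists_left_inverse (V l) (by rw [hrep.2.2 l]; exact (x.2.2 l).2)

/-- The alignment equations hold for all matrices drawn from the subspaces of a point of the
solution variety, not only for one affine representative. -/
lemma pairing_eq_zero_of_mem (hx : x ∈ P.solutionVariety) (p : P.Φ) {r s : ℕ}
    {h : P.ChMat p} (hh : h ∈ (projEquiv _ (x.1 p)).1)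
    {A : Matrix (Fin (P.N (P.rx p))) (Fin r) ℂ} (hA : ∀ j, A.col j ∈ (x.2.1 (P.rx p)).1)
    {B : Matrix (Fin (P.M (P.tx p))) (Fin s) ℂ} (hB : ∀ j, B.col j ∈ (x.2.2 (P.tx p)).1) :
    A.transpose * h * B = 0 := by
  obtain ⟨H, U, V, ⟨hH, hU, hV⟩, hal⟩ := hx
  obtain ⟨hne, hp⟩ := hH p
  rw [← hp, projEquiv_mk] at hh
  obtain ⟨c, rfl⟩ := Submodule.mem_span_singleton.1 hh
  obtain ⟨S, rfl⟩ := exists_eq_mul_of_col_mem (U (P.rx p)) A (by rw [hU]; exact hA)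
  obtain ⟨T, rfl⟩ := exists_eq_mul_of_col_mem (V (P.tx p)) B (by rw [hV]; exact hB)
  calc _ = c • (S.transpose * ((U (P.rx p)).transpose * H p * V (P.tx p)) * T) := by
        simp only [Matrix.transpose_mul, Matrix.mul_assoc, Matrix.smul_mul, Matrix.mul_smul]
    _ = 0 := by rw [hal p]; simp

lemma aligned_of_mem (hx : x ∈ P.solutionVariety) (hrep : P.IsRepresentative H U V x) :
    P.Aligned H U V := by
  intro p
  obtain ⟨hne, hp⟩ := hrep.1 p
  refine P.pairing_eq_zero_of_mem hx p ?_ (fun j => ?_) (fun j => ?_)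
  · rw [← hp, projEquiv_mk]
    exact Submodule.mem_span_singleton_self _
  · rw [← hrep.2.1]
    exact Submodule.subset_span ⟨j, rfl⟩
  · rw [← hrep.2.2]
    exact Submodule.subset_span ⟨j, rfl⟩

/-- Differentiating the alignment equations along a holomorphic curve in the solution variety: if
`H'` is a variation of `H` which represents the velocity of the channels, then `-(Uᵀ H' V)` is in the
range of `theta`. -/
lemma exists_theta_eq_of_curve (hrep : P.IsRepresentative H U V x)
    (γ : ℂ → P.InputSpace × P.OutputSpace) (h0 : γ 0 = x)
    (hmem : ∀ᶠ t in 𝓝 (0 : ℂ), γ t ∈ P.solutionVariety)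
    (v : ∀ p : P.Φ, GrModel 1 (Module.finrank ℂ (P.ChMat p) - 1)) (v' : _ × _)
    (hv : HasVelocity P.modelInput (fun t => (γ t).1) v)
    (hv' : HasVelocity P.modelOutput (fun t => (γ t).2) v')
    (H' : P.AffInput)
    (hH' : ∀ p, Represents (projEquiv _ (x.1 p)) (lineParam (H p)) (lineParam (H' p)) (v p)) :
    ∃ D, P.theta H U V D = fun p => -((U (P.rx p)).transpose * H' p * V (P.tx p)) := by
  subst h0
  have hx := hmem.self_of_nhds
  rw [hasVelocity_prodMk_iff] at hv'
  obtain ⟨hvU, hvV⟩ := hv'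
  rw [hasVelocity_pi_iff] at hv hvU hvV
  have cH := fun p => exists_vector_lift _ _ (hv p) (H p) (hrep.1 p).1 (hrep.1 p).2
  have cU := fun k => exists_lift_of_hasVelocity _ _ (hvU k) (U k).mulVecLin (by
    rw [Matrix.range_mulVecLin]; exact hrep.2.1 k)
  have cV := fun l => exists_lift_of_hasVelocity _ _ (hvV l) (V l).mulVecLin (by
    rw [Matrix.range_mulVecLin]; exact hrep.2.2 l)
  choose c c' hc0 hcr hcm hcd using cH
  choose F F' hF0 hFr hFm hFd using cU
  choose G G' hG0 hGr hGm hGd using cV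
  refine ⟨(fun k => LinearMap.toMatrix' (F' k), fun l => LinearMap.toMatrix' (G' l)), ?_⟩
  funext p
  have hUd := fun i j => hFd (P.rx p) (LinearMap.proj i) (Pi.single j 1)
  have hVd := fun i j => hGd (P.tx p) (LinearMap.proj i) (Pi.single j 1)
  have hHd := fun i j => hcd p (Matrix.entryLinearMap ℂ ℂ i j)
  have hd := hasDerivAt_transpose_mul_mul
    (A := fun t => LinearMap.toMatrix' (F (P.rx p) t)) (A' := LinearMap.toMatrix' (F' (P.rx p)))
    (B := c p) (B' := c' p)
    (C := fun t => LinearMap.toMatrix' (G (P.tx p) t)) (C' := LinearMap.toMatrix' (G' (P.tx p)))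
    (by simpa [LinearMap.toMatrix'_apply] using hUd) hHd
    (by simpa [LinearMap.toMatrix'_apply] using hVd)
  have hzero : ∀ᶠ t in 𝓝 (0 : ℂ), (LinearMap.toMatrix' (F (P.rx p) t)).transpose * c p t *
      LinearMap.toMatrix' (G (P.tx p) t) = 0 := by
    filter_upwards [hmem, hcm p, hFm (P.rx p), hGm (P.tx p)] with t ht h1 h2 h3
    refine P.pairing_eq_zero_of_mem ht p h1 (fun j => ?_) (fun j => ?_)
    · convert h2 (Pi.single j 1)
      ext i
      simp [LinearMap.toMatrix'_apply]
    · convert h3 (Pi.single j 1)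
      ext i
      simp [LinearMap.toMatrix'_apply]
  have hU0 : LinearMap.toMatrix' (F (P.rx p) 0) = U (P.rx p) := by
    rw [hF0, ← Matrix.toLin'_apply', LinearMap.toMatrix'_toLin']
  have hV0 : LinearMap.toMatrix' (G (P.tx p) 0) = V (P.tx p) := by
    rw [hG0, ← Matrix.toLin'_apply', LinearMap.toMatrix'_toLin']
  have hsum : (LinearMap.toMatrix' (F' (P.rx p))).transpose * H p * V (P.tx p) +
      (U (P.rx p)).transpose * c' p * V (P.tx p) +
      (U (P.rx p)).transpose * H p * LinearMap.toMatrix' (G' (P.tx p)) = 0 := by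
    ext i j
    have h1 := hd i j
    rw [hU0, hV0, hc0] at h1
    have h2 : HasDerivAt (fun _ : ℂ => (0 : ℂ)) _ 0 := h1.congr_of_eventuallyEq
      (hzero.mono fun t ht => (congrFun (congrFun ht i) j).symm)
    exact h2.unique (hasDerivAt_const _ _)
  -- The two representatives of the velocity of `H` differ by a multiple of `H`.
  have hdiff : (U (P.rx p)).transpose * (c' p - H' p) * V (P.tx p) = 0 := by
    refine P.pairing_eq_zero_of_mem hx p ?_ (fun j => ?_) (fun j => ?_)
    · simpa [lineParam_apply] using (hcr p).sub_mem (hH' p) 1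
    · rw [← hrep.2.1]
      exact Submodule.subset_span ⟨j, rfl⟩
    · rw [← hrep.2.2]
      exact Submodule.subset_span ⟨j, rfl⟩
  rw [Matrix.mul_sub, Matrix.sub_mul, sub_eq_zero] at hdiff
  rw [hdiff] at hsum
  change (LinearMap.toMatrix' (F' (P.rx p))).transpose * H p * V (P.tx p) +
    (U (P.rx p)).transpose * H p * LinearMap.toMatrix' (G' (P.tx p)) = _
  rw [eq_neg_iff_add_eq_zero, ← hsum]
  abel

/-- If `-(Uᵀ H' V)` is in the range of `theta`, then the variation `H'` of the channels is followed by
a holomorphic curve in the solution variety. -/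
lemma exists_curve_of_theta_eq (hx : x ∈ P.solutionVariety) (hrep : P.IsRepresentative H U V x)
    (v : ∀ p : P.Φ, GrModel 1 (Module.finrank ℂ (P.ChMat p) - 1)) (H' : P.AffInput)
    (hH' : ∀ p, Represents (projEquiv _ (x.1 p)) (lineParam (H p)) (lineParam (H' p)) (v p))
    (D : P.AffDecoder × P.AffPrecoder)
    (hD : P.theta H U V D = fun p => -((U (P.rx p)).transpose * H' p * V (P.tx p))) :
    ∃ (γ : ℂ → P.InputSpace × P.OutputSpace) (v' : _ × _), γ 0 = x ∧
      (∀ᶠ t in 𝓝 (0 : ℂ), γ t ∈ P.solutionVariety) ∧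
      HasVelocity P.modelInput (fun t => (γ t).1) v ∧
      HasVelocity P.modelOutput (fun t => (γ t).2) v' := by
  have hal := P.aligned_of_mem hx hrep
  choose LU hLU using P.exists_left_inverse_decoder hrep
  choose LV hLV using P.exists_left_inverse_precoder hrep
  choose X S hX hXU using fun k => exists_shear (U k) (D.1 k) (hLU k)
  choose Y T hY hYV using fun l => exists_shear (V l) (D.2 l) (hLV l)
  choose H₂ H₃ hexp using fun p => shear_expand (X (P.rx p)) (Y (P.tx p)) (H p) (H' p)
  -- Undoing the motions of the decoders and precoders changes the slope `H'` of the channels into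
  -- `H' + Xᵀ H + H Y`, which satisfies the same linear equations as `H`.
  have hH₁ : ∀ p, (U (P.rx p)).transpose *
      (H' p + (X (P.rx p)).transpose * H p + H p * Y (P.tx p)) * V (P.tx p) = 0 := by
    intro p
    have h1 : (U (P.rx p)).transpose * ((X (P.rx p)).transpose * H p) * V (P.tx p) =
        (D.1 (P.rx p)).transpose * H p * V (P.tx p) := by
      rw [← Matrix.mul_assoc, ← Matrix.transpose_mul, hXU, Matrix.transpose_sub,
        Matrix.transpose_mul, Matrix.sub_mul, Matrix.sub_mul, Matrix.mul_assoc _ _ (H p),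
        Matrix.mul_assoc (S (P.rx p)).transpose, hal p, Matrix.mul_zero, sub_zero]
    have h2 : (U (P.rx p)).transpose * (H p * Y (P.tx p)) * V (P.tx p) =
        (U (P.rx p)).transpose * H p * D.2 (P.tx p) := by
      rw [← Matrix.mul_assoc, Matrix.mul_assoc _ (Y (P.tx p)), hYV, Matrix.mul_sub,
        ← Matrix.mul_assoc _ (V (P.tx p)), hal p, Matrix.zero_mul, sub_zero]
    have h3 : (D.1 (P.rx p)).transpose * H p * V (P.tx p) +
        (U (P.rx p)).transpose * H p * D.2 (P.tx p) =
        -((U (P.rx p)).transpose * H' p * V (P.tx p)) := congrFun hD p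
    rw [Matrix.mul_add, Matrix.mul_add, Matrix.add_mul, Matrix.add_mul, h1, h2, add_assoc, h3,
      add_neg_cancel]
  have cH : ∀ p, ∃ γ : ℂ → ℙ ℂ (P.ChMat p), γ 0 = x.1 p ∧
      (∀ᶠ t in 𝓝 (0 : ℂ), ∃ h : H p + t • H' p + t ^ 2 • H₂ p + t ^ 3 • H₃ p ≠ 0,
        Projectivization.mk ℂ _ h = γ t) ∧ HasVelocity 𝓘(ℂ, GrModel 1 _) γ (v p) := by
    intro p
    have e : H p + (0 : ℂ) • H' p + (0 : ℂ) ^ 2 • H₂ p + (0 : ℂ) ^ 3 • H₃ p = H p := by simp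
    obtain ⟨hne, hp⟩ := hrep.1 p
    refine exists_hasVelocity_of_vector_lift (x.1 p)
      (fun t => H p + t • H' p + t ^ 2 • H₂ p + t ^ 3 • H₃ p) (H' p) (v p) (by rwa [e])
      (by simpa only [e] using hp) (contDiff_cubic _ _ _ _) (hasDerivAt_cubic _ _ _ _) ?_
    simpa only [e] using hH' p
  choose γH hγH0 hγH hγHv using cH
  choose γU wU hγU0 hγU hγUv using fun k =>
    exists_hasVelocity_motion (U k) (X k) (x.2.1 k) (hrep.2.1 k)
  choose γV wV hγV0 hγV hγVv using fun l =>
    exists_hasVelocity_motion (V l) (Y l) (x.2.2 l) (hrep.2.2 l)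
  refine ⟨fun t => (fun p => γH p t, (fun k => γU k t, fun l => γV l t)), (wU, wV), ?_, ?_, ?_, ?_⟩
  · simp only [hγH0, hγU0, hγV0]
  · filter_upwards [Filter.eventually_all.2 hγH, Filter.eventually_all.2 hγU,
      Filter.eventually_all.2 hγV] with t h1 h2 h3
    refine ⟨fun p => H p + t • H' p + t ^ 2 • H₂ p + t ^ 3 • H₃ p, fun k => (1 + t • X k) * U k,
      fun l => (1 + t • Y l) * V l, ⟨h1, h2, h3⟩, fun p => ?_⟩
    change ((1 + t • X (P.rx p)) * U (P.rx p)).transpose *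
      (H p + t • H' p + t ^ 2 • H₂ p + t ^ 3 • H₃ p) * ((1 + t • Y (P.tx p)) * V (P.tx p)) = 0
    rw [← hexp, shear_pairing (hX _) (hY _), Matrix.mul_add, Matrix.add_mul, hal p, Matrix.mul_smul,
      Matrix.smul_mul, hH₁, smul_zero, add_zero]
  · exact (hasVelocity_pi_iff _ _ _).2 hγHv
  · exact (hasVelocity_prodMk_iff _ _ _ _).2
      ⟨(hasVelocity_pi_iff _ _ _).2 hγUv, (hasVelocity_pi_iff _ _ _).2 hγVv⟩

end Channel

end InterferenceAlignment

theorem mainTheorem5 (P : InterferenceAlignment.Channel)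
    (x : P.InputSpace × P.OutputSpace) (hx : x ∈ P.solutionVariety)
    (H : P.AffInput) (U : P.AffDecoder) (V : P.AffPrecoder)
    (hrep : P.IsRepresentative H U V x) :
    InterferenceAlignment.IsRegularPoint (P.modelInput.prod P.modelOutput) P.modelInput
        Prod.fst P.solutionVariety x ↔
      Function.Surjective (P.theta H U V) := by
  have hspan : ∀ p, LinearMap.range (InterferenceAlignment.lineParam (H p)) =
      (InterferenceAlignment.projEquiv _ (x.1 p)).1 := by
    intro p
    obtain ⟨hne, hp⟩ := hrep.1 p
    rw [InterferenceAlignment.range_lineParam, ← hp, InterferenceAlignment.projEquiv_mk]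
  rw [InterferenceAlignment.isRegularPoint_fst_iff]
  constructor
  · intro hreg A
    choose LU hLU using P.exists_left_inverse_decoder hrep
    choose LV hLV using P.exists_left_inverse_precoder hrep
    -- With left inverses of `U` and `V`, every `A` is `-(Uᵀ H' V)` for a variation `H'`.
    let H' : P.AffInput := fun p => -((LU (P.rx p)).transpose * A p * LV (P.tx p))
    choose v hv using fun p =>
      InterferenceAlignment.exists_represents _ _ (InterferenceAlignment.lineParam (H' p)) (hspan p)
    obtain ⟨γ, v', h0, hmem, hγ, hγ'⟩ := hreg v
    obtain ⟨D, hD⟩ := P.exists_theta_eq_of_curve hrep γ h0 hmem v v' hγ hγ' H' hv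
    refine ⟨D, hD.trans (funext fun p => ?_)⟩
    calc _ = (LU (P.rx p) * U (P.rx p)).transpose * A p * (LV (P.tx p) * V (P.tx p)) := by
          simp only [H', Matrix.mul_neg, Matrix.neg_mul, neg_neg, Matrix.transpose_mul,
            Matrix.mul_assoc]
      _ = A p := by rw [hLU, hLV, Matrix.transpose_one, Matrix.one_mul, Matrix.mul_one]
  · intro hsurj v
    let H' : P.AffInput := fun p => InterferenceAlignment.grLift
      (InterferenceAlignment.projEquiv _ (x.1 p)) (InterferenceAlignment.lineParam (H p)) (v p) 1
    obtain ⟨D, hD⟩ := hsurj fun p => -((U (P.rx p)).transpose * H' p * V (P.tx p))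
    refine P.exists_curve_of_theta_eq hx hrep v H' (fun p => ?_) D hD
    rw [InterferenceAlignment.lineParam_eval_one]
    exact InterferenceAlignment.represents_grLift _ _ _
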